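/- Let $(\mathcal F,d)$ be a space with a pseudo-metric, let $\mathcal H$ be a separable real Hilbert space, and let $x\in\mathcal F$. All probabilities are conditional on the predictors: the design points $X_1,X_2,\ldots\in\mathcal F$ are fixed, the responses $Y_1,Y_2,\ldots$ are integrable $\mathcal H$-valued random elements, $E\,Y_i=r(X_i)$, and $\epsilon_i=Y_i-r(X_i)$. Assume the following. (1) The function $r:\mathcal F\to\mathcal H$ is bounded, and $\|r(y)-r(z)\|\le A\,d(y,z)^\alpha$ for all $y,z\in\mathcal F$, for some constants $A$ and $\alpha>0$. (2) For every $n\ge 1$, $(W_{n1},\ldots,W_{nn})$ is a probability vector. Let $R_1,\ldots,R_n$ be the ranking of $1,\ldots,n$ by increasing $d(X_i,x)$ (ties broken by index) and let $v_{ni}=W_{nR_i}$; then $v_{n1}\ge\cdots\ge v_{nn}$. There are integers $k=k_n\ge 0$ with $k/n\to0$ and $k/\log n\to\infty$, and nonnegative sequences $b_n,c_{n2}\to0$, with $\sum_{i=k+1}^n v_{ni}=O(b_n)$ and $(\sum_{i=1}^n v_{ni}^2)^{1/2}=O(c_{n2})$. The distance $H=H_n=\inf\{h:\#\{i\le n: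 d(X_i,x)\le h\}\ge k\}$ from $x$ to its $k$-th nearest neighbour tends to $0$. (3) Let $\psi(t)=\psi_p(t)=\exp(t^p)-1$ with $p\ge1$, and $\|Z\|_\psi=\inf\{C>0:E\,\psi(\|Z\|/C)\le1\}$. Then $\|\epsilon_i\|_\psi<\infty$, and $(\epsilon_i)_{i\ge1}$ is $\psi$-$m$-approximable with decay rate $(\gamma_k)_{k\ge1}$, $\gamma_k\ge0$: almost surely $\epsilon_i=h(\alpha_i,\alpha_{i-1},\ldots)$ for i.i.d. random elements $(\alpha_k)_{k\in\mathbb Z}$ of a measurable space and a measurable function $h$; and if $(\alpha_k')$ is an independent copy of $(\alpha_k)$ and $\epsilon_i^{(j)}=h(\alpha_i,\ldots,\alpha_{i-j+1},\alpha_{i-j}',\alpha_{i-j-1}',\ldots)$, then $\sum_{j\ge1}\|\epsilon_j-\epsilon_j^{(j)}\|_\psi<\infty$ and, for some constant $K$, $\sum_{j\ge k}\|\epsilon_j-\epsilon_j^{(j)}\|_\psi\le K\gamma_k$ for all $k\ge1$. Let $m=m_n$ be integers with $1\le m_n\le n$ such that, for all sufficiently large $C$, the sequence $$1/\psi\big(C(\log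 n)^2\,m_n/(n\,\gamma_{m_n})\big)$$ is summable over $n$, where a term with $\gamma_{m_n}=0$ counts as $0$ and the undefined term $n=1$ is disregarded. Then the estimate $\hat r(x)=\hat r_n(x)=\sum_{i=1}^nW_{ni}Y_i$ satisfies, almost surely as $n\to\infty$, $$\|\hat r(x)-r(x)\|=O\big(b_n+H^\alpha+(\log n)^2\,m_n\,c_{n2}+(\gamma_1v_{n1})^{1/2}\big).$$ -/

import Mathlib

open MeasureTheory ProbabilityTheory Filter Topology Asymptotics
open scoped ENNReal

universe u v w t

namespace FunctionalRegression

noncomputable section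

/-- The function `ψ_p(t) = exp(t^p) - 1`, used for `t ≥ 0`. -/
def psiExp (p : ℝ) (t : ℝ) : ℝ := Real.exp (t ^ p) - 1

/-- The Orlicz norm `‖Z‖_ψ = inf {C > 0 : E ψ(‖Z‖ / C) ≤ 1}` of a random element of a normed
space, with value `∞` if there is no such `C`. -/
def orliczNorm {Ω E : Type*} [MeasurableSpace Ω] [NormedAddCommGroup E]
    (ψ : ℝ → ℝ) (P : Measure Ω) (Z : Ω → E) : ℝ≥0∞ :=
  ⨅ (C : ℝ) (_ : 0 < C) (_ : ∫⁻ ω, ENNReal.ofReal (ψ (‖Z ω‖ / C)) ∂P ≤ 1), ENNReal.ofReal C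

/-- The variable `h(α_i, α_{i-1}, …, α_{i-m+1}, α'_{i-m}, α'_{i-m-1}, …)`. It lives on `Ω × Ω`:
`α` is read off the first coordinate and its independent copy `α'` off the second one. -/
def coupled {Ω S E : Type*} (h : (ℕ → S) → E) (α : ℤ → Ω → S) (i m : ℕ) (ω : Ω × Ω) : E :=
  h fun j : ℕ => if j < m then α ((i : ℤ) - (j : ℤ)) ω.1 else α ((i : ℤ) - (j : ℤ)) ω.2

/-- The sequence `ε_1, ε_2, …` (the entry with index `0` is not used) is `ψ-m`-approximable with
decay rate `γ_1, γ_2, …`: its Orlicz norms are finite, `ε_i = h(α_i, α_{i-1}, …)` with i.i.d. `α_k`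
and measurable `h`, `∑_{m ≥ 1} ‖ε_m - ε_m^{(m)}‖_ψ < ∞`, and
`∑_{m ≥ k} ‖ε_m - ε_m^{(m)}‖_ψ = O(γ_k)`, where `ε_m^{(m)}` is `coupled h α m m`. -/
def IsPsiMApproximable {Ω : Type u} {E : Type v} [MeasurableSpace Ω] [NormedAddCommGroup E]
    [MeasurableSpace E] (ψ : ℝ → ℝ) (P : Measure Ω) (ε : ℕ → Ω → E) (γ : ℕ → ℝ) : Prop :=
  (∀ i, 1 ≤ i → orliczNorm ψ P (ε i) < ∞) ∧
  ∃ (S : Type w) (_ : MeasurableSpace S) (α : ℤ → Ω → S) (h : (ℕ → S) → E),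
    (∀ k, Measurable (α k)) ∧ iIndepFun α P ∧ (∀ k, IdentDistrib (α k) (α 0) P P) ∧
    Measurable h ∧
    (∀ i, 1 ≤ i → ∀ᵐ ω ∂P, ε i ω = h fun j : ℕ => α ((i : ℤ) - (j : ℤ)) ω) ∧
    (∑' j : ℕ, orliczNorm ψ (P.prod P) (fun ω => ε (1 + j) ω.1 - coupled h α (1 + j) (1 + j) ω)
      < ∞) ∧
    ∃ K : ℝ, ∀ k, 1 ≤ k →
      ∑' j : ℕ, orliczNorm ψ (P.prod P) (fun ω => ε (k + j) ω.1 - coupled h α (k + j) (k + j) ω)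
        ≤ ENNReal.ofReal (K * γ k)

/-- The ranking of the first `n` design points by increasing distance to `x`, ties being broken by
indices (this is how `Tuple.sort` breaks them). The `i`-th observation, `1 ≤ i ≤ n`, corresponds to
the element `i - 1` of `Fin n`; likewise `ranking X x n ⟨i - 1, _⟩` is the `i`-th nearest
neighbour of `x`. -/
def ranking {F : Type*} [PseudoMetricSpace F] (X : ℕ → F) (x : F) (n : ℕ) : Equiv.Perm (Fin n) :=
  Tuple.sort fun i : Fin n => dist (X (i + 1)) x

/-- The weights in the order of the ranking: `v_{n,i+1} = W_{n,R_{i+1}}`, for `i < n`. -/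
def rankedWeight {F : Type*} [PseudoMetricSpace F] (X : ℕ → F) (x : F)
    (W : (n : ℕ) → Fin n → ℝ) (n : ℕ) (i : Fin n) : ℝ :=
  W n (ranking X x n i)

/-- The weight `v_{n1}` of the nearest neighbour (for `n ≥ 1`). -/
def firstWeight {F : Type*} [PseudoMetricSpace F] (X : ℕ → F) (x : F)
    (W : (n : ℕ) → Fin n → ℝ) (n : ℕ) : ℝ :=
  if h : 0 < n then rankedWeight X x W n ⟨0, h⟩ else 0

/-- The distance from `x` to its `k`-th nearest neighbour among the first `n` design points:
the infimum of all `h` such that at least `k` of them are in the closed ball `B(x, h)`. -/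
def knnDist {F : Type*} [PseudoMetricSpace F] (X : ℕ → F) (x : F) (n k : ℕ) : ℝ :=
  sInf {h : ℝ | k ≤ (Finset.univ.filter fun i : Fin n => dist (X (i + 1)) x ≤ h).card}

/-- The estimate `∑_{i=1}^n W_{ni} Y_i`. -/
def rHat {Ω E : Type*} [NormedAddCommGroup E] [NormedSpace ℝ E]
    (W : (n : ℕ) → Fin n → ℝ) (Y : ℕ → Ω → E) (n : ℕ) (ω : Ω) : E :=
  ∑ i : Fin n, W n i • Y (i + 1) ω

end

end FunctionalRegression

/-!
The estimation error is the sum of a bias and a noise term. The bias is deterministic: smoothness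
of `r` bounds the contribution of the `k` nearest neighbours by a multiple of `H ^ α`, and
boundedness of `r` that of the other points by a multiple of `b n` (`norm_bias_le`).

For the noise, `ε_i = h (α_i, α_{i-1}, …)` is compared with the conditional expectation `η_i` of
`ε_i` given the `m` innovations `α_i, …, α_{i-m+1}`; this is `headMean`, the average of
`h (α_i, …, α_{i-m+1}, y_m, y_{m+1}, …)` over an independent copy `y` of the past.

* By Jensen's inequality and stationarity the Orlicz norm of `ε_i - η_i` is at most that of
  `ε_m - ε_m^{(m)}`, which is `O(γ_m)`. The weights form a probability vector, so the same bound
  holds for `∑ W_i (ε_i - η_i)`, and Markov's inequality gives a tail bound of the form of the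
  summability condition (`measure_norm_sum_ge_le_of_convex`), because `(∑ W_i ^ 2) ^ (1/2)` is at
  least `1 / n`.
* The `η_i` are centred and `m`-dependent: along one residue class modulo `m` they are independent.
  In a Hilbert space `E cosh ‖∑ Z_i‖ ≤ ∏ E (exp ‖Z_i‖ - ‖Z_i‖)` for independent centred `Z_i`
  (`lintegral_cosh_norm_sum_le`), and this yields an exponential inequality on the scale
  `(∑ W_i ^ 2) ^ (1/2)` for each class. A union bound over the `m ≤ n` classes shows that
  `∑ W_i η_i` exceeds a multiple of `m log n (∑ W_i ^ 2) ^ (1/2)` with probability `O(n ^ (-2))`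
  (`measure_norm_sum_headMean_ge_le`).

The Borel–Cantelli lemma turns both bounds into almost sure ones. The noise is thus
`O((log n) ^ 2 m_n c_n)`; the term `(γ_1 v_{n1}) ^ (1/2)` of the rate is nonnegative and only enlarges
the bound.
-/

namespace FunctionalRegression

/-! ### Exponential moments of sums in a Hilbert space -/

/-- The function `z ↦ cosh √z` is convex on `[0, ∞)`, its power series having nonnegative
coefficients; the inequality is stated for the points `a ^ 2` and `b ^ 2`. -/
lemma cosh_sqrt_chord {a b θ : ℝ} (hθ : 0 ≤ θ) (hθ1 : θ ≤ 1) :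
    Real.cosh √((1 - θ) * a ^ 2 + θ * b ^ 2) ≤ (1 - θ) * Real.cosh a + θ * Real.cosh b := by
  refine hasSum_le (fun n => ?_) (Real.hasSum_cosh _)
    (((Real.hasSum_cosh a).mul_left _).add ((Real.hasSum_cosh b).mul_left _))
  have h1 : 0 ≤ 1 - θ := by linarith
  have h := (convexOn_pow (𝕜 := ℝ) n).2 (x := a ^ 2) (y := b ^ 2) (sq_nonneg a) (sq_nonneg b)
    h1 hθ (by ring)
  simp only [smul_eq_mul] at h
  rw [pow_mul, Real.sq_sqrt (by positivity), pow_mul a, pow_mul b, ← mul_div_assoc,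
    ← mul_div_assoc, ← add_div]
  gcongr

section Hilbert

variable {E : Type*} [NormedAddCommGroup E] [InnerProductSpace ℝ E]

/-- `cosh ‖s + x‖` is at most a multiple of `cosh ‖s‖` plus a term that is linear in `x`, and hence
disappears when a centred `x` is averaged. Since `‖s + x‖ ^ 2` is affine in `⟪s, x⟫`, which lies
between `± ‖s‖ ‖x‖`, this follows from the chord inequality for `cosh ∘ √`. -/
lemma cosh_norm_add_le (s x : E) :
    Real.cosh ‖s + x‖ ≤ Real.cosh ‖s‖ * (Real.exp ‖x‖ - ‖x‖)
      + inner ℝ ((Real.sinh ‖s‖ / ‖s‖) • s) x := by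
  rcases eq_or_ne s 0 with rfl | hs
  · have := (Real.self_le_sinh_iff (x := ‖x‖)).2 (norm_nonneg x)
    have := Real.cosh_add_sinh ‖x‖
    simp; linarith
  rcases eq_or_ne x 0 with rfl | hx
  · simp
  have hu : 0 < ‖s‖ := norm_pos_iff.2 hs
  have hv : 0 < ‖x‖ := norm_pos_iff.2 hx
  set u := ‖s‖
  set v := ‖x‖
  set y := inner ℝ s x
  have hy := abs_le.1 (abs_real_inner_le_norm s x)
  set ρ := y / (u * v) with hρ
  have hyρ : y = ρ * (u * v) := by rw [hρ]; field_simp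
  have h1 : -1 ≤ ρ := by rw [hρ, le_div_iff₀ (by positivity)]; linarith [hy.1]
  have h2 : ρ ≤ 1 := by rw [hρ, div_le_iff₀ (by positivity)]; linarith [hy.2]
  have hsq : ‖s + x‖ = √((1 - (1 + ρ) / 2) * |u - v| ^ 2 + (1 + ρ) / 2 * (u + v) ^ 2) := by
    rw [← Real.sqrt_sq (norm_nonneg (s + x)), norm_add_sq_real, sq_abs]
    congr 1
    change u ^ 2 + 2 * y + v ^ 2 = _
    rw [hyρ]; ring
  have key := cosh_sqrt_chord (a := |u - v|) (b := u + v) (θ := (1 + ρ) / 2)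
    (by linarith) (by linarith)
  rw [← hsq, Real.cosh_abs, Real.cosh_add, Real.cosh_sub] at key
  rw [real_inner_smul_left]
  change _ ≤ _ + Real.sinh u / u * y
  have e1 : Real.sinh u / u * y = ρ * v * Real.sinh u := by rw [hyρ]; field_simp
  rw [e1, ← Real.cosh_add_sinh v]
  -- the remainder of the linear term is at most `sinh u * (sinh v - v) ≤ cosh u * (sinh v - v)`
  have h3 : v ≤ Real.sinh v := Real.self_le_sinh_iff.2 hv.le
  have h4 : Real.sinh u ≤ Real.cosh u := (Real.sinh_lt_cosh u).le
  have h5 : 0 ≤ Real.sinh u := Real.sinh_nonneg_iff.2 hu.le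
  have h6 : ρ * Real.sinh u * (Real.sinh v - v) ≤ Real.cosh u * (Real.sinh v - v) := by
    exact mul_le_mul_of_nonneg_right ((mul_le_of_le_one_left h5 h2).trans h4) (by linarith)
  nlinarith

variable [CompleteSpace E] [MeasurableSpace E]

lemma lintegral_cosh_norm_add_le {μ : Measure E} [IsProbabilityMeasure μ]
    (hi : Integrable (fun x => Real.exp ‖x‖) μ) (hi1 : Integrable (fun x => x) μ)
    (h0 : ∫ x, x ∂μ = 0) (s : E) :
    ∫⁻ x, ENNReal.ofReal (Real.cosh ‖s + x‖) ∂μ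
      ≤ ENNReal.ofReal (Real.cosh ‖s‖) * ENNReal.ofReal (∫ x, (Real.exp ‖x‖ - ‖x‖) ∂μ) := by
  have hA : Integrable (fun x => Real.cosh ‖s‖ * (Real.exp ‖x‖ - ‖x‖)) μ :=
    (hi.sub hi1.norm).const_mul _
  have hL : Integrable (fun x => inner ℝ ((Real.sinh ‖s‖ / ‖s‖) • s) x) μ := hi1.const_inner _
  have hI : Integrable (fun x => Real.cosh ‖s‖ * (Real.exp ‖x‖ - ‖x‖)
      + inner ℝ ((Real.sinh ‖s‖ / ‖s‖) • s) x) μ := hA.add hL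
  calc ∫⁻ x, ENNReal.ofReal (Real.cosh ‖s + x‖) ∂μ
      ≤ ∫⁻ x, ENNReal.ofReal (Real.cosh ‖s‖ * (Real.exp ‖x‖ - ‖x‖)
        + inner ℝ ((Real.sinh ‖s‖ / ‖s‖) • s) x) ∂μ :=
        lintegral_mono fun x => ENNReal.ofReal_le_ofReal (cosh_norm_add_le s x)
    _ = ENNReal.ofReal (∫ x, (Real.cosh ‖s‖ * (Real.exp ‖x‖ - ‖x‖)
        + inner ℝ ((Real.sinh ‖s‖ / ‖s‖) • s) x) ∂μ) :=
        (ofReal_integral_eq_lintegral_ofReal hI (ae_of_all _ fun x =>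
          (Real.cosh_pos _).le.trans (cosh_norm_add_le s x))).symm
    _ = _ := by
        rw [integral_add hA hL,
          integral_inner hi1, h0, inner_zero_right, add_zero, integral_const_mul,
          ENNReal.ofReal_mul (Real.cosh_pos _).le]

variable [SecondCountableTopology E] [BorelSpace E]

/-- The factor of each summand is of second order in its size, which in a Hilbert space replaces the
Laplace transform bound of the real-valued case. -/
lemma lintegral_cosh_norm_sum_le {Ω ι : Type*} [MeasurableSpace Ω] {P : Measure Ω}
    [IsProbabilityMeasure P] {Z : ι → Ω → E} (hind : iIndepFun Z P) (hm : ∀ i, Measurable (Z i))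
    (hi : ∀ i, Integrable (fun ω => Real.exp ‖Z i ω‖) P) (hi1 : ∀ i, Integrable (Z i) P)
    (h0 : ∀ i, ∫ ω, Z i ω ∂P = 0) (s : Finset ι) :
    ∫⁻ ω, ENNReal.ofReal (Real.cosh ‖∑ i ∈ s, Z i ω‖) ∂P
      ≤ ∏ i ∈ s, ENNReal.ofReal (∫ ω, (Real.exp ‖Z i ω‖ - ‖Z i ω‖) ∂P) := by
  classical
  induction s using Finset.induction_on with
  | empty => simp
  | insert i s his ih =>
    have hind' : IndepFun (∑ j ∈ s, Z j) (Z i) P := hind.indepFun_finsetSum_of_notMem hm his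
    have hms : Measurable (∑ j ∈ s, Z j) := by
      rw [Finset.sum_fn]
      exact Finset.measurable_sum _ fun j _ => hm j
    have hprod := (indepFun_iff_map_prod_eq_prod_map_map hms.aemeasurable
      (hm i).aemeasurable).1 hind'
    have hc : Continuous fun q : E × E => ENNReal.ofReal (Real.cosh ‖q.1 + q.2‖) := by
      exact ENNReal.continuous_ofReal.comp (Real.continuous_cosh.comp (by fun_prop))
    have hc1 : Continuous fun q : E => ENNReal.ofReal (Real.cosh ‖q‖) := by
      exact ENNReal.continuous_ofReal.comp (Real.continuous_cosh.comp (by fun_prop))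
    have := Measure.isProbabilityMeasure_map (μ := P) (hm i).aemeasurable
    have := Measure.isProbabilityMeasure_map (μ := P) hms.aemeasurable
    have hcm : Measurable fun x : E => Real.exp ‖x‖ := by fun_prop
    -- averaging over the last summand with the others fixed
    calc ∫⁻ ω, ENNReal.ofReal (Real.cosh ‖∑ j ∈ insert i s, Z j ω‖) ∂P
        = ∫⁻ ω, ENNReal.ofReal (Real.cosh ‖(∑ j ∈ s, Z j) ω + Z i ω‖) ∂P := by
          simp only [Finset.sum_insert his, Finset.sum_apply, add_comm]
      _ = ∫⁻ q, ENNReal.ofReal (Real.cosh ‖q.1 + q.2‖)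
            ∂(P.map (∑ j ∈ s, Z j)).prod (P.map (Z i)) := by
          rw [← hprod, lintegral_map hc.measurable (hms.prodMk (hm i))]
      _ = ∫⁻ y, ∫⁻ x, ENNReal.ofReal (Real.cosh ‖y + x‖) ∂P.map (Z i)
            ∂P.map (∑ j ∈ s, Z j) := lintegral_prod _ hc.measurable.aemeasurable
      _ ≤ ∫⁻ y, ENNReal.ofReal (Real.cosh ‖y‖) * ENNReal.ofReal
            (∫ x, (Real.exp ‖x‖ - ‖x‖) ∂P.map (Z i)) ∂P.map (∑ j ∈ s, Z j) := by
          refine lintegral_mono fun y => lintegral_cosh_norm_add_le ?_ ?_ ?_ y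
          · rw [integrable_map_measure hcm.aestronglyMeasurable (hm i).aemeasurable]
            exact hi i
          · exact (integrable_map_measure (g := fun x : E => x)
              measurable_id.aestronglyMeasurable (hm i).aemeasurable).2 (hi1 i)
          · exact (integral_map (f := fun x : E => x) (hm i).aemeasurable
              measurable_id.aestronglyMeasurable).trans (h0 i)
      _ = (∫⁻ ω, ENNReal.ofReal (Real.cosh ‖∑ j ∈ s, Z j ω‖) ∂P) *
            ENNReal.ofReal (∫ ω, (Real.exp ‖Z i ω‖ - ‖Z i ω‖) ∂P) := by
          rw [lintegral_mul_const _ hc1.measurable, lintegral_map hc1.measurable hms,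
            integral_map (f := fun x => Real.exp ‖x‖ - ‖x‖) (hm i).aemeasurable
              (hcm.sub measurable_norm).aestronglyMeasurable]
          simp only [Finset.sum_apply]
      _ ≤ _ := by
          rw [Finset.prod_insert his, mul_comm]
          gcongr

end Hilbert

/-! ### The Orlicz function -/

section Orlicz

variable {p : ℝ} {E : Type*} [NormedAddCommGroup E]

lemma psiExp_mono (hp : 0 ≤ p) {s t : ℝ} (hs : 0 ≤ s) (hst : s ≤ t) :
    psiExp p s ≤ psiExp p t := by
  unfold psiExp
  gcongr

lemma psiExp_nonneg {t : ℝ} (ht : 0 ≤ t) : 0 ≤ psiExp p t :=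
  sub_nonneg.2 (Real.one_le_exp (by positivity))

lemma psiExp_pos {t : ℝ} (ht : 0 < t) : 0 < psiExp p t :=
  sub_pos.2 (Real.one_lt_exp_iff.2 (by positivity))

lemma le_psiExp (hp : 1 ≤ p) {t : ℝ} (ht : 1 ≤ t) : t ≤ psiExp p t := by
  have h1 := Real.add_one_le_exp (t ^ p)
  have h2 := Real.self_le_rpow_of_one_le ht hp
  unfold psiExp
  linarith

lemma exp_le_psiExp (hp : 1 ≤ p) {t : ℝ} (ht : 0 ≤ t) :
    Real.exp t ≤ Real.exp 1 * (psiExp p t + 1) := by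
  rw [psiExp, sub_add_cancel, ← Real.exp_add, Real.exp_le_exp]
  rcases le_total t 1 with h | h
  · have : 0 ≤ t ^ p := by positivity
    linarith
  · have := Real.self_le_rpow_of_one_le h hp
    linarith

lemma continuous_psiExp (hp : 0 ≤ p) : Continuous (psiExp p) :=
  (Real.continuous_exp.comp (Real.continuous_rpow_const hp)).sub continuous_const

lemma convexOn_psiExp (hp : 1 ≤ p) : ConvexOn ℝ (Set.Ici 0) (psiExp p) := by
  have h : ConvexOn ℝ (Set.Ici 0) fun t : ℝ => Real.exp (t ^ p) := by
    refine ⟨convex_Ici 0, fun x hx y hy a b ha hb hab => ?_⟩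
    exact (Real.exp_le_exp.2 ((convexOn_rpow hp).2 hx hy ha hb hab)).trans
      (convexOn_exp.2 (Set.mem_univ _) (Set.mem_univ _) ha hb hab)
  exact h.sub (concaveOn_const 1 (convex_Ici 0))

lemma continuous_psiExp_norm (hp : 0 ≤ p) (C : ℝ) :
    Continuous fun z : E => psiExp p (‖z‖ / C) :=
  (continuous_psiExp hp).comp (by fun_prop)

/-- The infimum in the definition of the Orlicz norm need not be attained, whence the strict
inequality. -/
lemma lintegral_psiExp_le_one_of_orliczNorm_lt {Ω : Type*} [MeasurableSpace Ω] {P : Measure Ω}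
    {Z : Ω → E} (hp : 0 ≤ p) {C : ℝ}
    (h : orliczNorm (psiExp p) P Z < ENNReal.ofReal C) :
    ∫⁻ ω, ENNReal.ofReal (psiExp p (‖Z ω‖ / C)) ∂P ≤ 1 := by
  simp only [orliczNorm, iInf_lt_iff] at h
  obtain ⟨C', hC', hle, hlt⟩ := h
  have hCC := (ENNReal.ofReal_lt_ofReal_iff_of_nonneg hC'.le).1 hlt
  refine (lintegral_mono fun ω => ENNReal.ofReal_le_ofReal
    (psiExp_mono hp ?_ ?_)).trans hle
  · have := hC'.trans hCC
    positivity
  · gcongr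

variable [NormedSpace ℝ E]

lemma convexOn_psiExp_norm (hp : 1 ≤ p) {C : ℝ} (hC : 0 ≤ C) :
    ConvexOn ℝ Set.univ fun z : E => psiExp p (‖z‖ / C) := by
  refine ⟨convex_univ, fun x _ y _ a b ha hb hab => ?_⟩
  refine le_trans ?_ ((convexOn_psiExp hp).2 (x := ‖x‖ / C) (y := ‖y‖ / C)
    (Set.mem_Ici.2 (by positivity)) (Set.mem_Ici.2 (by positivity)) ha hb hab)
  refine psiExp_mono (by linarith) (by positivity) ?_
  have h : ‖a • x + b • y‖ ≤ a * ‖x‖ + b * ‖y‖ :=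
    (norm_add_le _ _).trans_eq (by rw [norm_smul, norm_smul, Real.norm_of_nonneg ha,
      Real.norm_of_nonneg hb])
  calc ‖a • x + b • y‖ / C ≤ (a * ‖x‖ + b * ‖y‖) / C := by gcongr
    _ = _ := by simp only [smul_eq_mul]; ring

/-- Jensen's inequality for the convex function `z ↦ ψ (‖z‖ / C)`; the right-hand side may be
infinite. -/
lemma ofReal_psiExp_norm_integral_le [CompleteSpace E] (hp : 1 ≤ p) {C : ℝ} (hC : 0 ≤ C)
    {T : Type*} [MeasurableSpace T] {μ : Measure T} [IsProbabilityMeasure μ] {f : T → E}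
    (hf : Integrable f μ) :
    ENNReal.ofReal (psiExp p (‖∫ y, f y ∂μ‖ / C))
      ≤ ∫⁻ y, ENNReal.ofReal (psiExp p (‖f y‖ / C)) ∂μ := by
  have hc := continuous_psiExp_norm (p := p) (E := E) (by linarith) C
  have h0 : ∀ y, 0 ≤ psiExp p (‖f y‖ / C) := fun y => psiExp_nonneg (by positivity)
  by_cases hfin : ∫⁻ y, ENNReal.ofReal (psiExp p (‖f y‖ / C)) ∂μ = ∞
  · rw [hfin]; exact le_top
  have hi : Integrable (fun y => psiExp p (‖f y‖ / C)) μ :=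
    (lintegral_ofReal_ne_top_iff_integrable (hc.comp_aestronglyMeasurable hf.1)
      (ae_of_all _ h0)).1 hfin
  rw [← ofReal_integral_eq_lintegral_ofReal hi (ae_of_all _ h0)]
  exact ENNReal.ofReal_le_ofReal ((convexOn_psiExp_norm hp hC).map_integral_le hc.continuousOn
    isClosed_univ (ae_of_all _ fun _ => Set.mem_univ _) hf hi)

end Orlicz

/-! ### Averaging over the remote past -/

section Splice

variable {S : Type*} [MeasurableSpace S]

/-- The sequence that has its first `m` entries from `x` and the others from `y`. -/
def splice (m : ℕ) (x y : ℕ → S) : ℕ → S := fun j => if j < m then x j else y j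

lemma measurable_splice (m : ℕ) :
    Measurable fun q : (ℕ → S) × (ℕ → S) => splice m q.1 q.2 := by
  refine measurable_pi_iff.2 fun j => ?_
  by_cases hj : j < m <;> simp only [splice, hj, if_true, if_false] <;> fun_prop

/-- Replacing the tail of an i.i.d. sequence by that of an independent copy does not change its
law. -/
lemma map_splice (ν : Measure S) [IsProbabilityMeasure ν] (m : ℕ) :
    ((Measure.infinitePi fun _ : ℕ => ν).prod (Measure.infinitePi fun _ : ℕ => ν)).map
      (fun q => splice m q.1 q.2) = Measure.infinitePi fun _ : ℕ => ν := by
  refine Measure.eq_infinitePi _ fun s t ht => ?_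
  rw [Measure.map_apply (measurable_splice m)
    (MeasurableSet.pi s.countable_toSet fun i _ => ht i)]
  have : (fun q : (ℕ → S) × (ℕ → S) => splice m q.1 q.2) ⁻¹' Set.pi s t
      = (Set.pi (s.filter (· < m)) t) ×ˢ (Set.pi (s.filter fun j => ¬ j < m) t) := by
    ext q
    simp only [Set.mem_preimage, Set.mem_pi, Finset.mem_coe, Set.mem_prod, Finset.mem_filter,
      splice]
    constructor
    · intro h
      exact ⟨fun i hi => by simpa [hi.2] using h i hi.1, fun i hi => by simpa [hi.2] using h i hi.1⟩
    · intro h i hi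
      by_cases him : i < m
      · simpa [him] using h.1 i ⟨hi, him⟩
      · simpa [him] using h.2 i ⟨hi, him⟩
  rw [this, Measure.prod_prod, Measure.infinitePi_pi _ fun i _ => ht i,
    Measure.infinitePi_pi _ fun i _ => ht i, Finset.prod_filter_mul_prod_filter_not]

variable {E : Type*} [NormedAddCommGroup E]

/-- The mean of `h (x₀, …, x_{m-1}, y_m, y_{m+1}, …)` over `y` with law `μ`. When `μ` is the law
of an i.i.d. sequence this is the conditional expectation of `h` given the first `m` entries. -/
noncomputable def headMean [NormedSpace ℝ E] (h : (ℕ → S) → E) (μ : Measure (ℕ → S)) (m : ℕ)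
    (x : ℕ → S) : E :=
  ∫ y, h (splice m x y) ∂μ

variable [MeasurableSpace E] [BorelSpace E] [SecondCountableTopology E]
  {h : (ℕ → S) → E} (hh : Measurable h) (ν : Measure S) [IsProbabilityMeasure ν] (m : ℕ)

include hh

lemma integrable_splice (hi : Integrable h (Measure.infinitePi fun _ : ℕ => ν)) :
    Integrable (fun q : (ℕ → S) × (ℕ → S) => h (splice m q.1 q.2))
      ((Measure.infinitePi fun _ : ℕ => ν).prod (Measure.infinitePi fun _ : ℕ => ν)) := by
  have := (map_splice ν m).symm ▸ hi
  exact (integrable_map_measure hh.aestronglyMeasurable (measurable_splice m).aemeasurable).1 this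

variable [NormedSpace ℝ E]

lemma measurable_headMean : Measurable (headMean h (Measure.infinitePi fun _ : ℕ => ν) m) :=
  (StronglyMeasurable.integral_prod_right' (f := fun q : (ℕ → S) × (ℕ → S) => h (splice m q.1 q.2))
    (hh.comp (measurable_splice m)).stronglyMeasurable).measurable

lemma integrable_headMean (hi : Integrable h (Measure.infinitePi fun _ : ℕ => ν)) :
    Integrable (headMean h (Measure.infinitePi fun _ : ℕ => ν) m)
      (Measure.infinitePi fun _ : ℕ => ν) :=
  (integrable_splice hh ν m hi).integral_prod_left

lemma integral_headMean (hi : Integrable h (Measure.infinitePi fun _ : ℕ => ν)) :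
    ∫ x, headMean h (Measure.infinitePi fun _ : ℕ => ν) m x ∂(Measure.infinitePi fun _ : ℕ => ν)
      = ∫ x, h x ∂(Measure.infinitePi fun _ : ℕ => ν) := by
  have h1 := integral_prod _ (integrable_splice hh ν m hi)
  have h2 := integral_map (f := h) (measurable_splice m).aemeasurable
    (μ := (Measure.infinitePi fun _ : ℕ => ν).prod (Measure.infinitePi fun _ : ℕ => ν))
    hh.aestronglyMeasurable
  rw [map_splice] at h2
  exact h1.symm.trans h2.symm

variable [CompleteSpace E] {p : ℝ} (hp : 1 ≤ p) {C : ℝ} (hC : 0 ≤ C)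

include hp hC

lemma lintegral_psiExp_headMean_le (hi : Integrable h (Measure.infinitePi fun _ : ℕ => ν)) :
    ∫⁻ x, ENNReal.ofReal (psiExp p (‖headMean h (Measure.infinitePi fun _ : ℕ => ν) m x‖ / C))
        ∂(Measure.infinitePi fun _ : ℕ => ν)
      ≤ ∫⁻ x, ENNReal.ofReal (psiExp p (‖h x‖ / C)) ∂(Measure.infinitePi fun _ : ℕ => ν) := by
  set μ := Measure.infinitePi fun _ : ℕ => ν with hμ
  have hc : Measurable fun z : E => ENNReal.ofReal (psiExp p (‖z‖ / C)) :=
    ENNReal.measurable_ofReal.comp (continuous_psiExp_norm (by linarith) C).measurable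
  calc _ ≤ ∫⁻ x, ∫⁻ y, ENNReal.ofReal (psiExp p (‖h (splice m x y)‖ / C)) ∂μ ∂μ := by
        refine lintegral_mono_ae ?_
        filter_upwards [(integrable_splice hh ν m hi).prod_right_ae] with x hx
        exact ofReal_psiExp_norm_integral_le hp hC hx
    _ = ∫⁻ q, ENNReal.ofReal (psiExp p (‖h (splice m q.1 q.2)‖ / C)) ∂(μ.prod μ) :=
        (lintegral_prod _ (hc.comp (hh.comp (measurable_splice m))).aemeasurable).symm
    _ = _ := by
        rw [← lintegral_map (f := fun x => ENNReal.ofReal (psiExp p (‖h x‖ / C))) (hc.comp hh)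
          (measurable_splice m), map_splice]

lemma lintegral_psiExp_sub_headMean_le (hi : Integrable h (Measure.infinitePi fun _ : ℕ => ν)) :
    ∫⁻ x, ENNReal.ofReal
        (psiExp p (‖h x - headMean h (Measure.infinitePi fun _ : ℕ => ν) m x‖ / C))
        ∂(Measure.infinitePi fun _ : ℕ => ν)
      ≤ ∫⁻ q, ENNReal.ofReal (psiExp p (‖h q.1 - h (splice m q.1 q.2)‖ / C))
        ∂((Measure.infinitePi fun _ : ℕ => ν).prod (Measure.infinitePi fun _ : ℕ => ν)) := by
  set μ := Measure.infinitePi fun _ : ℕ => ν with hμ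
  have hc : Measurable fun z : E => ENNReal.ofReal (psiExp p (‖z‖ / C)) :=
    ENNReal.measurable_ofReal.comp (continuous_psiExp_norm (by linarith) C).measurable
  rw [lintegral_prod (fun q : (ℕ → S) × (ℕ → S) =>
    ENNReal.ofReal (psiExp p (‖h q.1 - h (splice m q.1 q.2)‖ / C)))
    (hc.comp ((hh.comp measurable_fst).sub (hh.comp (measurable_splice m)))).aemeasurable]
  refine lintegral_mono_ae ?_
  filter_upwards [(integrable_splice hh ν m hi).prod_right_ae] with x hx
  have : h x - headMean h μ m x = ∫ y, (h x - h (splice m x y)) ∂μ := by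
    rw [integral_sub (integrable_const _) hx]
    simp [headMean, hμ]
  rw [this]
  exact ofReal_psiExp_norm_integral_le hp hC ((integrable_const _).sub hx)

end Splice

/-! ### The past of an i.i.d. sequence -/

section Past

variable {Ω S : Type*} [MeasurableSpace Ω] [MeasurableSpace S] {P : Measure Ω}
  {α : ℤ → Ω → S}

/-- The sequence `α_i, α_{i-1}, α_{i-2}, …`. -/
def past (α : ℤ → Ω → S) (i : ℤ) (ω : Ω) : ℕ → S := fun j => α (i - j) ω

lemma measurable_past (hm : ∀ k, Measurable (α k)) (i : ℤ) : Measurable (past α i) :=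
  measurable_pi_iff.2 fun j => hm (i - j)

lemma map_past (hm : ∀ k, Measurable (α k)) (hind : iIndepFun α P)
    (hid : ∀ k, IdentDistrib (α k) (α 0) P P) (i : ℤ) :
    P.map (past α i) = Measure.infinitePi fun _ : ℕ => P.map (α 0) := by
  have hinj : Function.Injective fun j : ℕ => i - (j : ℤ) := fun a b hab => by
    simpa using hab
  have h := (hind.precomp hinj).map_fun_eq_infinitePi_map fun j : ℕ => hm (i - (j : ℤ))
  simpa only [(hid _).map_eq] using! h

/-- Functions of pairwise disjoint groups of independent variables are independent. -/
lemma iIndepFun_of_disjoint_groups (hm : ∀ k, Measurable (α k))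
    (hind : iIndepFun α P)
    {ι E : Type*} [MeasurableSpace E] {Z : ι → Ω → E} (D : ι → Set ℤ)
    (hD : Pairwise fun i j => Disjoint (D i) (D j))
    (hZ : ∀ i, Measurable[⨆ k ∈ D i, MeasurableSpace.comap (α k) inferInstance] (Z i)) :
    iIndepFun Z P := by
  classical
  have := hind.isProbabilityMeasure
  refine iIndepFun_iff_measure_inter_preimage_eq_mul.2 fun s A hA => ?_
  induction s using Finset.induction_on with
  | empty => simp
  | insert i s his ih =>
    have hI := indep_iSup_of_disjoint (fun k => (hm k).comap_le) hind.iIndep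
      (S := D i) (T := ⋃ j ∈ s, D j) (by
        simp only [Set.disjoint_iUnion_right]
        exact fun j hj => hD fun h => his (h ▸ hj))
    rw [Finset.prod_insert his, Finset.set_biInter_insert,
      ← ih fun j hj => hA j (Finset.mem_insert_of_mem hj)]
    refine (Indep_iff _ _ P).1 hI _ _ (hZ i (hA i (Finset.mem_insert_self _ _))) ?_
    refine Finset.measurableSet_biInter s fun j hj => ?_
    have hle : (⨆ k ∈ D j, MeasurableSpace.comap (α k) inferInstance)
        ≤ ⨆ k ∈ ⋃ j ∈ s, D j, MeasurableSpace.comap (α k) inferInstance :=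
      biSup_mono fun k hk => Set.mem_biUnion hj hk
    exact hle _ (hZ j (hA j (Finset.mem_insert_of_mem hj)))

/-- At times that are at least `m` apart, the approximations that use only `m` innovations are
independent. -/
lemma iIndepFun_headMean {E : Type*} [NormedAddCommGroup E] [NormedSpace ℝ E] [MeasurableSpace E]
    [BorelSpace E] [SecondCountableTopology E] (hm : ∀ k, Measurable (α k)) (hind : iIndepFun α P)
    {h : (ℕ → S) → E} (hh : Measurable h) (μ : Measure (ℕ → S)) [SFinite μ] (m : ℕ)
    {ι : Type*} (τ : ι → ℤ) (hτ : ∀ i j, τ i < τ j → τ i + m ≤ τ j)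
    (hτi : Function.Injective τ) :
    iIndepFun (fun i ω => headMean h μ m (past α (τ i) ω)) P := by
  refine iIndepFun_of_disjoint_groups hm hind (fun i => Set.Ioc (τ i - m) (τ i)) ?_ ?_
  · intro i j hij
    refine Set.disjoint_left.2 fun a ha hb => ?_
    rw [Set.mem_Ioc] at ha hb
    rcases lt_trichotomy (τ i) (τ j) with hlt | heq | hlt
    · have := hτ i j hlt; omega
    · exact hij (hτi heq)
    · have := hτ j i hlt; omega
  intro i
  have hmem : ∀ j : ℕ, j < m → τ i - j ∈ Set.Ioc (τ i - m) (τ i) := fun j hj => by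
    rw [Set.mem_Ioc]; omega
  let φ : (Set.Ioc (τ i - m) (τ i) → S) → E := fun z =>
    ∫ y, h (fun j : ℕ => if hj : j < m then z ⟨τ i - j, hmem j hj⟩ else y j) ∂μ
  have hφ : Measurable φ := by
    refine (StronglyMeasurable.integral_prod_right'
      (f := fun q : (Set.Ioc (τ i - m) (τ i) → S) × (ℕ → S) =>
        h (fun j : ℕ => if hj : j < m then q.1 ⟨τ i - j, hmem j hj⟩ else q.2 j))
      (hh.comp (measurable_pi_iff.2 fun j => ?_)).stronglyMeasurable).measurable
    by_cases hj : j < m <;> simp only [hj, dite_true, dite_false] <;> fun_prop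
  refine hφ.comp (f := fun ω (z : Set.Ioc (τ i - m) (τ i)) => α z ω) ?_
  refine @measurable_pi_lambda _ _ _ (_) _ _ fun z => ?_
  exact (comap_measurable (α z)).mono
    (le_iSup₂_of_le (f := fun k (_ : k ∈ Set.Ioc (τ i - m) (τ i)) =>
      MeasurableSpace.comap (α k) inferInstance) z.1 z.2 le_rfl) le_rfl

end Past

/-! ### Tail bounds -/

section Tail

/-- The series of `exp x - 1 - x` starts with the quadratic term, so that scaling the argument by
`q ≤ 1` gains a factor `q²`. -/
lemma exp_mul_sub_le {q y : ℝ} (hq : 0 ≤ q) (hq1 : q ≤ 1) (hy : 0 ≤ y) :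
    Real.exp (q * y) - q * y ≤ 1 + q ^ 2 * Real.exp y := by
  have hs : ∀ x : ℝ, HasSum (fun n : ℕ => x ^ (n + 2) / ((n + 2).factorial : ℝ))
      (Real.exp x - (1 + x)) := fun x => by
    have h := NormedSpace.expSeries_div_hasSum_exp (𝔸 := ℝ) x
    rw [← Real.exp_eq_exp_ℝ] at h
    simpa [Finset.sum_range_succ] using (hasSum_nat_add_iff' 2).2 h
  have h := hasSum_le (fun n => ?_) (hs (q * y)) ((hs y).mul_left (q ^ 2))
  · nlinarith [sq_nonneg q]
  · have h1 : q ^ n ≤ 1 := pow_le_one₀ hq hq1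
    rw [← mul_div_assoc]
    gcongr
    calc (q * y) ^ (n + 2) = q ^ n * (q ^ 2 * y ^ (n + 2)) := by ring
      _ ≤ 1 * (q ^ 2 * y ^ (n + 2)) := by gcongr
      _ = _ := one_mul _

variable {Ω : Type*} [MeasurableSpace Ω] {P : Measure Ω}
  {E : Type*} [NormedAddCommGroup E] [MeasurableSpace E] [BorelSpace E]

/-- Since `exp t ≤ e * (ψ t + 1)`, the constant is an upper bound for `2 * e`. -/
lemma integrable_exp_and_integral_exp_le [IsProbabilityMeasure P] {p D : ℝ} (hp : 1 ≤ p)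
    (hD : 0 < D) {ξ : Ω → E}
    (hm : Measurable ξ) (hψ : ∫⁻ ω, ENNReal.ofReal (psiExp p (‖ξ ω‖ / D)) ∂P ≤ 1) :
    Integrable (fun ω => Real.exp (‖ξ ω‖ / D)) P ∧ ∫ ω, Real.exp (‖ξ ω‖ / D) ∂P ≤ 6 := by
  have hmn : Measurable fun ω => ‖ξ ω‖ / D := hm.norm.div_const D
  have hme : Measurable fun ω => Real.exp (‖ξ ω‖ / D) := Real.measurable_exp.comp hmn
  have hmp : Measurable fun ω => ENNReal.ofReal (psiExp p (‖ξ ω‖ / D)) :=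
    ENNReal.measurable_ofReal.comp ((continuous_psiExp (by linarith)).measurable.comp hmn)
  have hle : ∫⁻ ω, ENNReal.ofReal (Real.exp (‖ξ ω‖ / D)) ∂P ≤ ENNReal.ofReal 6 := by
    calc ∫⁻ ω, ENNReal.ofReal (Real.exp (‖ξ ω‖ / D)) ∂P
        ≤ ∫⁻ ω, ENNReal.ofReal (Real.exp 1)
            * (ENNReal.ofReal (psiExp p (‖ξ ω‖ / D)) + ENNReal.ofReal 1) ∂P := by
          refine lintegral_mono fun ω => ?_
          rw [← ENNReal.ofReal_add (psiExp_nonneg (by positivity)) zero_le_one,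
            ← ENNReal.ofReal_mul (Real.exp_pos 1).le]
          exact ENNReal.ofReal_le_ofReal (exp_le_psiExp hp (by positivity))
      _ = ENNReal.ofReal (Real.exp 1)
            * (∫⁻ ω, ENNReal.ofReal (psiExp p (‖ξ ω‖ / D)) ∂P + ENNReal.ofReal 1) := by
          rw [lintegral_const_mul _ (hmp.add_const _), lintegral_add_left hmp]
          simp
      _ ≤ ENNReal.ofReal (Real.exp 1) * (ENNReal.ofReal 1 + ENNReal.ofReal 1) := by
          gcongr
          simpa using hψ
      _ ≤ ENNReal.ofReal 6 := by
          rw [← ENNReal.ofReal_add zero_le_one zero_le_one,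
            ← ENNReal.ofReal_mul (Real.exp_pos 1).le]
          exact ENNReal.ofReal_le_ofReal (by linarith [Real.exp_one_lt_d9])
  have hi : Integrable (fun ω => Real.exp (‖ξ ω‖ / D)) P :=
    (lintegral_ofReal_ne_top_iff_integrable hme.aestronglyMeasurable
      (ae_of_all _ fun ω => (Real.exp_pos _).le)).1 (hle.trans_lt ENNReal.ofReal_lt_top).ne
  refine ⟨hi, ?_⟩
  rw [← ofReal_integral_eq_lintegral_ofReal hi (ae_of_all _ fun ω => (Real.exp_pos _).le)] at hle
  exact (ENNReal.ofReal_le_ofReal_iff (by norm_num)).1 hle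

/-- Markov's inequality for a convex combination of random elements whose Orlicz norms are at most
`C`; no independence is needed. -/
lemma measure_norm_sum_ge_le_of_convex [NormedSpace ℝ E] [SecondCountableTopology E] {p C t : ℝ}
    (hp : 1 ≤ p) (hC : 0 < C)
    (ht : 0 < t) {ι : Type*} [Fintype ι] {w : ι → ℝ} (hw : ∀ i, 0 ≤ w i) (hw1 : ∑ i, w i = 1)
    {ζ : ι → Ω → E} (hm : ∀ i, Measurable (ζ i))
    (hψ : ∀ i, ∫⁻ ω, ENNReal.ofReal (psiExp p (‖ζ i ω‖ / C)) ∂P ≤ 1) :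
    P {ω | t ≤ ‖∑ i, w i • ζ i ω‖} ≤ ENNReal.ofReal (1 / psiExp p (t / C)) := by
  have hc : Measurable fun z : E => psiExp p (‖z‖ / C) :=
    (continuous_psiExp_norm (by linarith) C).measurable
  have hmψ : ∀ i, Measurable fun ω => ENNReal.ofReal (psiExp p (‖ζ i ω‖ / C)) := fun i =>
    (hc.comp (hm i)).ennreal_ofReal
  have hpos : 0 < psiExp p (t / C) := psiExp_pos (by positivity)
  have hint : ∫⁻ ω, ENNReal.ofReal (psiExp p (‖∑ i, w i • ζ i ω‖ / C)) ∂P ≤ 1 := by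
    calc _ ≤ ∫⁻ ω, ∑ i, ENNReal.ofReal (w i) * ENNReal.ofReal (psiExp p (‖ζ i ω‖ / C)) ∂P := by
          refine lintegral_mono fun ω => ?_
          refine (ENNReal.ofReal_le_ofReal ((convexOn_psiExp_norm hp hC.le).map_sum_le
            (fun i _ => hw i) hw1 fun i _ => Set.mem_univ _)).trans_eq ?_
          simp only [smul_eq_mul]
          rw [ENNReal.ofReal_sum_of_nonneg fun i _ =>
            mul_nonneg (hw i) (psiExp_nonneg (div_nonneg (norm_nonneg _) hC.le))]
          exact Finset.sum_congr rfl fun i _ => ENNReal.ofReal_mul (hw i)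
      _ = ∑ i, ENNReal.ofReal (w i) * ∫⁻ ω, ENNReal.ofReal (psiExp p (‖ζ i ω‖ / C)) ∂P := by
          rw [lintegral_finsetSum _ fun i _ => (hmψ i).const_mul _]
          exact Finset.sum_congr rfl fun i _ => lintegral_const_mul _ (hmψ i)
      _ ≤ ∑ i, ENNReal.ofReal (w i) * 1 := by gcongr; exact hψ _
      _ = 1 := by
          simp only [mul_one]
          rw [← ENNReal.ofReal_sum_of_nonneg fun i _ => hw i, hw1, ENNReal.ofReal_one]
  have hmS : Measurable fun ω => ∑ i, w i • ζ i ω :=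
    Finset.measurable_sum _ fun i _ => (hm i).const_smul (w i)
  calc P {ω | t ≤ ‖∑ i, w i • ζ i ω‖}
      ≤ P {ω | ENNReal.ofReal (psiExp p (t / C))
          ≤ ENNReal.ofReal (psiExp p (‖∑ i, w i • ζ i ω‖ / C))} := by
        refine measure_mono fun ω hω => ENNReal.ofReal_le_ofReal (psiExp_mono (by linarith)
          (by positivity) ?_)
        have : t ≤ ‖∑ i, w i • ζ i ω‖ := hω
        gcongr
    _ ≤ (∫⁻ ω, ENNReal.ofReal (psiExp p (‖∑ i, w i • ζ i ω‖ / C)) ∂P)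
          / ENNReal.ofReal (psiExp p (t / C)) :=
        meas_ge_le_lintegral_div (hc.comp hmS).ennreal_ofReal.aemeasurable
          (ENNReal.ofReal_pos.2 hpos).ne' ENNReal.ofReal_ne_top
    _ ≤ 1 / ENNReal.ofReal (psiExp p (t / C)) := by gcongr
    _ = _ := by rw [ENNReal.ofReal_div_of_pos hpos, ENNReal.ofReal_one]

variable [IsProbabilityMeasure P] [InnerProductSpace ℝ E] [CompleteSpace E]
  [SecondCountableTopology E]

/-- An exponential inequality for weighted sums of independent centred random elements of a
Hilbert space with Orlicz norms at most `D`. -/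
lemma measure_norm_sum_ge_le_of_iIndepFun {p D s t : ℝ} (hp : 1 ≤ p) (hD : 0 < D) (hs : 0 < s)
    (ht : 0 ≤ t) {ι : Type*} [Fintype ι] {w : ι → ℝ} (hw : ∀ i, 0 ≤ w i)
    (hws : ∑ i, w i ^ 2 ≤ s ^ 2) {ξ : ι → Ω → E} (hind : iIndepFun ξ P)
    (hm : ∀ i, Measurable (ξ i)) (hi : ∀ i, Integrable (ξ i) P) (h0 : ∀ i, ∫ ω, ξ i ω ∂P = 0)
    (hψ : ∀ i, ∫⁻ ω, ENNReal.ofReal (psiExp p (‖ξ i ω‖ / D)) ∂P ≤ 1) :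
    P {ω | D * s * t ≤ ‖∑ i, w i • ξ i ω‖}
      ≤ ENNReal.ofReal (2 * Real.exp 6 * Real.exp (-t)) := by
  have hq0 : ∀ i, 0 ≤ w i / s := fun i => div_nonneg (hw i) hs.le
  have hq1 : ∀ i, w i / s ≤ 1 := fun i => by
    rw [div_le_one hs]
    refine le_of_sq_le_sq ?_ hs.le
    exact (Finset.single_le_sum (f := fun i => w i ^ 2) (fun i _ => sq_nonneg _)
      (Finset.mem_univ i)).trans hws
  let Z : ι → Ω → E := fun i ω => (w i / (D * s)) • ξ i ω
  have hZn : ∀ i ω, ‖Z i ω‖ = w i / s * (‖ξ i ω‖ / D) := fun i ω => by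
    have := hw i
    rw [norm_smul, Real.norm_of_nonneg (by positivity)]
    field_simp
  have hZm : ∀ i, Measurable (Z i) := fun i => (hm i).const_smul (w i / (D * s))
  have hZi : ∀ i, Integrable (Z i) P := fun i => (hi i).smul (w i / (D * s))
  have hexp := fun i => integrable_exp_and_integral_exp_le hp hD (hm i) (hψ i)
  have hZe : ∀ i, Integrable (fun ω => Real.exp ‖Z i ω‖) P := fun i => by
    refine (hexp i).1.mono' (Real.measurable_exp.comp (hZm i).norm).aestronglyMeasurable
      (ae_of_all _ fun ω => ?_)
    rw [Real.norm_of_nonneg (Real.exp_pos _).le, hZn, Real.exp_le_exp]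
    exact mul_le_of_le_one_left (by positivity) (hq1 i)
  have hcosh := lintegral_cosh_norm_sum_le (P := P) (Z := Z)
    (hind.comp (fun i x => (w i / (D * s)) • x) fun i => measurable_const_smul _) hZm hZe hZi
    (fun i => by rw [integral_smul, h0 i, smul_zero]) Finset.univ
  have hfac : ∀ i, ∫ ω, (Real.exp ‖Z i ω‖ - ‖Z i ω‖) ∂P ≤ Real.exp (6 * (w i / s) ^ 2) := by
    intro i
    calc ∫ ω, (Real.exp ‖Z i ω‖ - ‖Z i ω‖) ∂P
        ≤ ∫ ω, (1 + (w i / s) ^ 2 * Real.exp (‖ξ i ω‖ / D)) ∂P := by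
          refine integral_mono ((hZe i).sub (hZi i).norm)
            ((integrable_const _).add ((hexp i).1.const_mul _)) fun ω => ?_
          simp only [hZn]
          exact exp_mul_sub_le (hq0 i) (hq1 i) (by positivity)
      _ = 1 + (w i / s) ^ 2 * ∫ ω, Real.exp (‖ξ i ω‖ / D) ∂P := by
          rw [integral_add (integrable_const _) ((hexp i).1.const_mul _), integral_const_mul]
          simp
      _ ≤ 1 + (w i / s) ^ 2 * 6 := by gcongr; exact (hexp i).2
      _ ≤ Real.exp (6 * (w i / s) ^ 2) := by
          have := Real.add_one_le_exp (6 * (w i / s) ^ 2)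
          linarith
  have hprod : ∏ i, ENNReal.ofReal (∫ ω, (Real.exp ‖Z i ω‖ - ‖Z i ω‖) ∂P)
      ≤ ENNReal.ofReal (Real.exp 6) := by
    calc _ ≤ ∏ i, ENNReal.ofReal (Real.exp (6 * (w i / s) ^ 2)) :=
          Finset.prod_le_prod' fun i _ => ENNReal.ofReal_le_ofReal (hfac i)
      _ = ENNReal.ofReal (Real.exp (∑ i, 6 * (w i / s) ^ 2)) := by
          rw [Real.exp_sum, ENNReal.ofReal_prod_of_nonneg fun i _ => (Real.exp_pos _).le]
      _ ≤ _ := by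
          refine ENNReal.ofReal_le_ofReal (Real.exp_le_exp.2 ?_)
          rw [← Finset.mul_sum]
          simp only [div_pow]
          rw [← Finset.sum_div]
          have : (∑ i, w i ^ 2) / s ^ 2 ≤ 1 := (div_le_one (by positivity)).2 hws
          linarith
  have hsum : ∀ ω, ‖∑ i, w i • ξ i ω‖ = D * s * ‖∑ i, Z i ω‖ := fun ω => by
    have hn : D * s * ‖∑ i, Z i ω‖ = ‖(D * s) • ∑ i, Z i ω‖ := by
      rw [norm_smul, Real.norm_of_nonneg (mul_pos hD hs).le]
    rw [hn, Finset.smul_sum]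
    congr 1
    refine Finset.sum_congr rfl fun i _ => ?_
    rw [smul_smul, mul_div_cancel₀ _ (mul_pos hD hs).ne']
  have hcp : 0 < Real.cosh t := Real.cosh_pos t
  have hmc : Measurable fun ω => Real.cosh ‖∑ i, Z i ω‖ :=
    Real.measurable_cosh.comp (Finset.measurable_sum _ fun i _ => hZm i).norm
  calc P {ω | D * s * t ≤ ‖∑ i, w i • ξ i ω‖}
      ≤ P {ω | ENNReal.ofReal (Real.cosh t) ≤ ENNReal.ofReal (Real.cosh ‖∑ i, Z i ω‖)} := by
        refine measure_mono fun ω hω => ENNReal.ofReal_le_ofReal (Real.cosh_le_cosh.2 ?_)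
        have hω' : D * s * t ≤ ‖∑ i, w i • ξ i ω‖ := hω
        rw [hsum] at hω'
        rw [abs_of_nonneg ht, abs_norm]
        exact le_of_mul_le_mul_left hω' (mul_pos hD hs)
    _ ≤ (∫⁻ ω, ENNReal.ofReal (Real.cosh ‖∑ i, Z i ω‖) ∂P) / ENNReal.ofReal (Real.cosh t) :=
        meas_ge_le_lintegral_div hmc.ennreal_ofReal.aemeasurable
          (ENNReal.ofReal_pos.2 hcp).ne' ENNReal.ofReal_ne_top
    _ ≤ ENNReal.ofReal (Real.exp 6) / ENNReal.ofReal (Real.cosh t) := by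
        gcongr
        exact hcosh.trans hprod
    _ = ENNReal.ofReal (Real.exp 6 / Real.cosh t) := (ENNReal.ofReal_div_of_pos hcp).symm
    _ ≤ _ := by
        refine ENNReal.ofReal_le_ofReal ?_
        rw [div_le_iff₀ hcp, Real.cosh_eq]
        have h1 : Real.exp (-t) * Real.exp t = 1 := by rw [← Real.exp_add]; simp
        have h2 := Real.exp_pos (-t)
        have h3 := Real.exp_pos 6
        have : 2 * Real.exp 6 * Real.exp (-t) * ((Real.exp t + Real.exp (-t)) / 2)
            = Real.exp 6 * (Real.exp (-t) * Real.exp t) + Real.exp 6 * Real.exp (-t) ^ 2 := by ring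
        rw [this, h1]
        have : 0 ≤ Real.exp 6 * Real.exp (-t) ^ 2 := by positivity
        linarith

/-- The exponential inequality for weighted sums of the `m`-dependent approximations: the indices
of one residue class modulo `m` give an independent sum. -/
lemma measure_norm_sum_headMean_ge_le {S : Type*} [MeasurableSpace S] {α : ℤ → Ω → S}
    (hα : ∀ k, Measurable (α k)) (hind : iIndepFun α P)
    (hid : ∀ k, IdentDistrib (α k) (α 0) P P) {h : (ℕ → S) → E} (hh : Measurable h)
    {μ : Measure (ℕ → S)} (hμ : μ = Measure.infinitePi fun _ : ℕ => P.map (α 0))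
    (hi : Integrable h μ) (h0 : ∫ x, h x ∂μ = 0) {p D s t : ℝ} (hp : 1 ≤ p) (hD : 0 < D)
    (hψ : ∫⁻ x, ENNReal.ofReal (psiExp p (‖h x‖ / D)) ∂μ ≤ 1) (hs : 0 < s) (ht : 0 ≤ t)
    {n m : ℕ} (hm : 1 ≤ m) {w : Fin n → ℝ} (hw : ∀ i, 0 ≤ w i) (hws : ∑ i, w i ^ 2 ≤ s ^ 2) :
    P {ω | m * (D * s * t) ≤ ‖∑ i, w i • headMean h μ m (past α ((i : ℕ) + 1 : ℕ) ω)‖}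
      ≤ m * ENNReal.ofReal (2 * Real.exp 6 * Real.exp (-t)) := by
  have hν : IsProbabilityMeasure (P.map (α 0)) :=
    Measure.isProbabilityMeasure_map (hα 0).aemeasurable
  have hT : ∀ i, Measurable (past α i) := measurable_past hα
  have hTμ : ∀ i, P.map (past α i) = μ := fun i => (map_past hα hind hid i).trans hμ.symm
  have hgm : Measurable (headMean h μ m) := hμ ▸ measurable_headMean hh (P.map (α 0)) m
  have hgi : Integrable (headMean h μ m) μ := by
    subst hμ; exact integrable_headMean hh _ m hi
  have hg0 : ∫ x, headMean h μ m x ∂μ = 0 := by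
    subst hμ; exact (integral_headMean hh _ m hi).trans h0
  have hgψ : ∫⁻ x, ENNReal.ofReal (psiExp p (‖headMean h μ m x‖ / D)) ∂μ ≤ 1 := by
    subst hμ; exact (lintegral_psiExp_headMean_le hh _ m hp hD.le hi).trans hψ
  have hμp : IsProbabilityMeasure μ := by subst hμ; infer_instance
  have hcψ : Measurable fun x => ENNReal.ofReal (psiExp p (‖headMean h μ m x‖ / D)) :=
    ((continuous_psiExp_norm (by linarith) D).measurable.comp hgm).ennreal_ofReal
  have hm0 : 0 < m := hm
  let ρ : Fin n → Fin m := fun i => ⟨i % m, Nat.mod_lt _ hm0⟩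
  have hclass : ∀ j : Fin m, P {ω | D * s * t ≤ ‖∑ i : {i : Fin n // ρ i = j},
      w i • headMean h μ m (past α (((i : Fin n) : ℕ) + 1 : ℕ) ω)‖}
      ≤ ENNReal.ofReal (2 * Real.exp 6 * Real.exp (-t)) := by
    intro j
    refine measure_norm_sum_ge_le_of_iIndepFun (ι := {i : Fin n // ρ i = j})
      (w := fun i => w i)
      (ξ := fun i ω => headMean h μ m (past α (((i : Fin n) : ℕ) + 1 : ℕ) ω))
      hp hD hs ht (fun i => hw i) ?_
      (iIndepFun_headMean hα hind hh μ m
        (fun i : {i : Fin n // ρ i = j} => ((((i : Fin n) : ℕ) + 1 : ℕ) : ℤ)) ?_ ?_)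
      (fun i => hgm.comp (hT _)) (fun i => ?_) (fun i => ?_) (fun i => ?_)
    · refine le_trans ?_ hws
      rw [← Finset.sum_subtype (Finset.univ.filter fun i => ρ i = j) (by simp)
        fun i => w i ^ 2]
      exact Finset.sum_le_sum_of_subset_of_nonneg (Finset.subset_univ _)
        fun i _ _ => sq_nonneg _
    · rintro ⟨a, ha⟩ ⟨b, hb⟩ hab
      -- distinct numbers of the same residue class modulo `m` differ by at least `m`
      have hmod : (a : ℕ) ≡ b [MOD m] := by
        have := ha.trans hb.symm
        simpa [ρ, Nat.ModEq] using this
      have hlt : (a : ℕ) < b := by simpa using hab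
      have := Nat.le_of_dvd (by omega) ((Nat.modEq_iff_dvd' hlt.le).1 hmod)
      push_cast
      omega
    · intro a b hab
      exact Subtype.ext (Fin.ext (by simpa using hab))
    · exact (integrable_map_measure hgm.aestronglyMeasurable (hT _).aemeasurable).1
        (by rw [hTμ]; exact hgi)
    · refine (integral_map (hT _).aemeasurable hgm.aestronglyMeasurable).symm.trans ?_
      rw [hTμ]
      exact hg0
    · rw [← lintegral_map hcψ (hT _), hTμ]
      exact hgψ
  calc P {ω | m * (D * s * t) ≤ ‖∑ i, w i • headMean h μ m (past α ((i : ℕ) + 1 : ℕ) ω)‖}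
      ≤ P (⋃ j : Fin m, {ω | D * s * t ≤ ‖∑ i : {i : Fin n // ρ i = j},
        w i • headMean h μ m (past α (((i : Fin n) : ℕ) + 1 : ℕ) ω)‖}) := by
        refine measure_mono fun ω hω => ?_
        have hω' : m * (D * s * t)
          ≤ ‖∑ i, w i • headMean h μ m (past α ((i : ℕ) + 1 : ℕ) ω)‖ := hω
        rw [← Fintype.sum_fiberwise ρ] at hω'
        have hle : ∑ _j : Fin m, D * s * t ≤ ∑ j : Fin m, ‖∑ i : {i : Fin n // ρ i = j},
            w i • headMean h μ m (past α (((i : Fin n) : ℕ) + 1 : ℕ) ω)‖ := by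
          refine le_trans ?_ (hω'.trans (norm_sum_le _ _))
          simp
        obtain ⟨j, -, hj⟩ := Finset.exists_le_of_sum_le ⟨⟨0, hm0⟩, Finset.mem_univ _⟩ hle
        exact Set.mem_iUnion.2 ⟨j, hj⟩
    _ ≤ ∑ j : Fin m, ENNReal.ofReal (2 * Real.exp 6 * Real.exp (-t)) :=
        (measure_iUnion_fintype_le _ _).trans (Finset.sum_le_sum fun j _ => hclass j)
    _ = _ := by simp

end Tail

/-! ### The bias -/

section Bias

variable {F : Type*} [PseudoMetricSpace F] (X : ℕ → F) (x : F)

lemma knnDist_nonneg (n k : ℕ) : 0 ≤ knnDist X x n k := by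
  rcases Nat.eq_zero_or_pos k with rfl | hk
  · simp [knnDist]
  · refine Real.sInf_nonneg fun h hh => ?_
    obtain ⟨i, hi⟩ := Finset.card_pos.1 (hk.trans_le hh)
    exact dist_nonneg.trans (Finset.mem_filter.1 hi).2

lemma dist_ranking_le_knnDist {n k : ℕ} (hkn : k ≤ n) {i : Fin n} (hi : (i : ℕ) < k) :
    dist (X (ranking X x n i + 1)) x ≤ knnDist X x n k := by
  refine le_csInf ⟨∑ j : Fin n, dist (X (j + 1)) x, ?_⟩ fun h hh => ?_
  · have : (Finset.univ.filter fun j : Fin n =>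
        dist (X (j + 1)) x ≤ ∑ j : Fin n, dist (X (j + 1)) x) = Finset.univ :=
      Finset.filter_true_of_mem fun j _ => Finset.single_le_sum
        (f := fun j : Fin n => dist (X (j + 1)) x) (fun _ _ => dist_nonneg) (Finset.mem_univ j)
    rw [Set.mem_ofPred_eq, this]
    simpa using hkn
  · by_contra! hlt
    -- all points with distance at most `h` have a rank below `i`
    have hsub : (Finset.univ.filter fun j : Fin n => dist (X (j + 1)) x ≤ h)
        ⊆ (Finset.Iio i).map (ranking X x n).toEmbedding := by
      intro j hj
      obtain ⟨l, rfl⟩ := (ranking X x n).surjective j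
      refine Finset.mem_map.2 ⟨l, Finset.mem_Iio.2 ?_, rfl⟩
      by_contra! hil
      have := Tuple.monotone_sort (fun i : Fin n => dist (X (i + 1)) x) hil
      exact absurd ((Finset.mem_filter.1 hj).2) (not_le.2 (hlt.trans_le this))
    have := Finset.card_le_card hsub
    rw [Finset.card_map, Fin.card_Iio] at this
    have hh' : k ≤ _ := hh
    omega

/-- The bias is controlled by the smoothness of `r` for the `k` nearest neighbours, and by the
boundedness of `r` for the others. -/
lemma norm_bias_le {E : Type*} [NormedAddCommGroup E] [NormedSpace ℝ E] {r : F → E}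
    {α A B : ℝ} (hα : 0 < α) (hB : ∀ y, ‖r y‖ ≤ B) (hA : ∀ y z, ‖r y - r z‖ ≤ A * dist y z ^ α)
    {W : (n : ℕ) → Fin n → ℝ} {n k : ℕ} (hW0 : ∀ i, 0 ≤ W n i) (hW1 : ∑ i, W n i = 1)
    (hkn : k ≤ n) :
    ‖∑ i : Fin n, W n i • (r (X (i + 1)) - r x)‖ ≤ |A| * knnDist X x n k ^ α
      + 2 * B * ∑ i ∈ Finset.univ.filter (fun i : Fin n => k ≤ (i : ℕ)),
        rankedWeight X x W n i := by
  set H := knnDist X x n k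
  have hH : 0 ≤ H := knnDist_nonneg X x n k
  have hv0 : ∀ i, 0 ≤ rankedWeight X x W n i := fun i => hW0 _
  have hv1 : ∑ i, rankedWeight X x W n i = 1 :=
    (Equiv.sum_comp (ranking X x n) (W n)).trans hW1
  rw [← Equiv.sum_comp (ranking X x n), Finset.sum_filter, Finset.mul_sum]
  calc _ ≤ ∑ i, (rankedWeight X x W n i * (|A| * H ^ α)
        + 2 * B * if k ≤ (i : ℕ) then rankedWeight X x W n i else 0) := by
        refine norm_sum_le_of_le _ fun i _ => ?_
        rw [norm_smul, Real.norm_of_nonneg (hW0 _)]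
        change rankedWeight X x W n i * _ ≤ _
        have hv := hv0 i
        split_ifs with hi
        · have h2 : ‖r (X (ranking X x n i + 1)) - r x‖ ≤ 2 * B :=
            (norm_sub_le _ _).trans (by linarith [hB (X (ranking X x n i + 1)), hB x])
          have h3 : 0 ≤ rankedWeight X x W n i * (|A| * H ^ α) := by positivity
          nlinarith [mul_le_mul_of_nonneg_left h2 hv]
        · rw [mul_zero, add_zero]
          refine mul_le_mul_of_nonneg_left ((hA _ _).trans ?_) hv
          have := dist_ranking_le_knnDist X x hkn (not_le.1 hi)
          gcongr
          exact le_abs_self A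
    _ = _ := by rw [Finset.sum_add_distrib, ← Finset.sum_mul, hv1, one_mul]

end Bias

/-! ### Stationarity of the approximation error -/

section Noise

variable {Ω S E : Type*} [MeasurableSpace Ω] {P : Measure Ω} [IsProbabilityMeasure P]
  [MeasurableSpace S] {α : ℤ → Ω → S} [NormedAddCommGroup E] [NormedSpace ℝ E] [MeasurableSpace E]
  [BorelSpace E] [SecondCountableTopology E] [CompleteSpace E] {h : (ℕ → S) → E}

/-- By stationarity, a bound for the Orlicz norm of `ε_m - ε_m^{(m)}` carries over to the error
of the `m`-dependent approximation at all times. -/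
lemma lintegral_psiExp_sub_headMean_le_one (hα : ∀ k, Measurable (α k)) (hind : iIndepFun α P)
    (hid : ∀ k, IdentDistrib (α k) (α 0) P P) (hh : Measurable h)
    {μ : Measure (ℕ → S)} (hμ : μ = Measure.infinitePi fun _ : ℕ => P.map (α 0))
    (hi : Integrable h μ) {p C : ℝ} (hp : 1 ≤ p) (hC : 0 < C) {m : ℕ} {ξ : Ω → E}
    (hξ : ξ =ᵐ[P] fun ω => h (past α m ω))
    (hlt : orliczNorm (psiExp p) (P.prod P) (fun ω => ξ ω.1 - coupled h α m m ω)
      < ENNReal.ofReal C) :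
    ∫⁻ x, ENNReal.ofReal (psiExp p (‖h x - headMean h μ m x‖ / C)) ∂μ ≤ 1 := by
  have hν : IsProbabilityMeasure (P.map (α 0)) :=
    Measure.isProbabilityMeasure_map (hα 0).aemeasurable
  have hT : Measurable (past α m) := measurable_past hα m
  have hTμ : P.map (past α m) = μ := (map_past hα hind hid m).trans hμ.symm
  have hmeas : Measurable fun q : (ℕ → S) × (ℕ → S) =>
      ENNReal.ofReal (psiExp p (‖h q.1 - h (splice m q.1 q.2)‖ / C)) :=
    ((continuous_psiExp_norm (by linarith) C).measurable.comp
      ((hh.comp measurable_fst).sub (hh.comp (measurable_splice m)))).ennreal_ofReal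
  have hprod : ∫⁻ q, ENNReal.ofReal (psiExp p (‖h q.1 - h (splice m q.1 q.2)‖ / C)) ∂(μ.prod μ)
      ≤ 1 := by
    rw [← hTμ, Measure.map_prod_map _ _ hT hT, lintegral_map hmeas (hT.prodMap hT)]
    refine (lintegral_mono_ae ?_).trans
      (lintegral_psiExp_le_one_of_orliczNorm_lt (by linarith) hlt)
    filter_upwards [Measure.quasiMeasurePreserving_fst.ae hξ] with ω hω
    rw [hω]
    rfl
  subst hμ
  exact (lintegral_psiExp_sub_headMean_le hh _ m hp hC.le hi).trans hprod

end Noise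

/-- A probability vector of length `n` has Euclidean norm at least `1 / n`. -/
lemma one_div_le_sqrt_sum_sq {n : ℕ} (hn : 1 ≤ n) {w : Fin n → ℝ} (hw1 : ∑ i, w i = 1) :
    1 / (n : ℝ) ≤ √(∑ i, w i ^ 2) := by
  have hn' : (1 : ℝ) ≤ n := by exact_mod_cast hn
  have h := sq_sum_le_card_mul_sum_sq (s := Finset.univ) (f := w)
  rw [hw1, Finset.card_univ, Fintype.card_fin] at h
  refine Real.le_sqrt_of_sq_le ?_
  rw [div_pow, div_le_iff₀ (by positivity)]
  nlinarith [Finset.sum_nonneg fun i (_ : i ∈ Finset.univ) => sq_nonneg (w i)]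

end FunctionalRegression

/-! ### Almost sure rate -/

open FunctionalRegression

theorem corollary2
    {Ω : Type u} [MeasurableSpace Ω] (P : Measure Ω) [IsProbabilityMeasure P]
    {F : Type t} [PseudoMetricSpace F]
    {E : Type v} [NormedAddCommGroup E] [InnerProductSpace ℝ E] [CompleteSpace E]
    [SecondCountableTopology E] [MeasurableSpace E] [BorelSpace E]
    -- the design points, the responses, the regression function and the target point
    (X : ℕ → F) (Y : ℕ → Ω → E) (r : F → E) (x : F)
    (hY : ∀ i, 1 ≤ i → Integrable (Y i) P)
    (hr : ∀ i, 1 ≤ i → ∫ ω, Y i ω ∂P = r (X i))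
    -- the regression function is bounded and Lipschitz of order `α`
    (α B A : ℝ) (hα : 0 < α) (hB : ∀ y, ‖r y‖ ≤ B)
    (hA : ∀ y z, ‖r y - r z‖ ≤ A * dist y z ^ α)
    -- the weights
    (W : (n : ℕ) → Fin n → ℝ)
    (hW0 : ∀ n i, 0 ≤ W n i) (hW1 : ∀ n, 1 ≤ n → ∑ i, W n i = 1)
    (hv : ∀ n, Antitone (FunctionalRegression.rankedWeight X x W n))
    (k : ℕ → ℕ) (hkn : Tendsto (fun n : ℕ => (k n : ℝ) / n) atTop (𝓝 0))
    (hklog : Tendsto (fun n : ℕ => (k n : ℝ) / Real.log n) atTop atTop)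
    (b c : ℕ → ℝ) (hb0 : ∀ n, 0 ≤ b n) (hc0 : ∀ n, 0 ≤ c n)
    (hb : Tendsto b atTop (𝓝 0)) (hc : Tendsto c atTop (𝓝 0))
    (hvb : (fun n => ∑ i ∈ Finset.univ.filter (fun i : Fin n => k n ≤ (i : ℕ)),
      FunctionalRegression.rankedWeight X x W n i) =O[atTop] b)
    (hvc : (fun n => Real.sqrt (∑ i, FunctionalRegression.rankedWeight X x W n i ^ 2))
      =O[atTop] c)
    (hH : Tendsto (fun n => FunctionalRegression.knnDist X x n (k n)) atTop (𝓝 0))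
    -- the noise
    (p : ℝ) (hp : 1 ≤ p) (γ : ℕ → ℝ) (hγ : ∀ j, 1 ≤ j → 0 ≤ γ j)
    (hε : FunctionalRegression.IsPsiMApproximable.{u, v, w} (FunctionalRegression.psiExp p) P
      (fun i ω => Y i ω - r (X i)) γ)
    -- the block lengths and the summability condition
    (m : ℕ → ℕ) (hm : ∀ n, 1 ≤ n → 1 ≤ m n ∧ m n ≤ n)
    (hsum : ∀ᶠ C : ℝ in atTop, Summable fun n : ℕ =>
      1 / FunctionalRegression.psiExp p (C * Real.log n ^ 2 * m n / (n * γ (m n)))) :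
    ∀ᵐ ω ∂P, (fun n : ℕ => ‖FunctionalRegression.rHat W Y n ω - r x‖) =O[atTop]
      (fun n : ℕ => b n + FunctionalRegression.knnDist X x n (k n) ^ α
        + Real.log n ^ 2 * m n * c n
        + Real.sqrt (γ 1 * FunctionalRegression.firstWeight X x W n)) := by
  classical
  obtain ⟨hfin, S, _, β, h, hβ, hind, hid, hh, hrep, -, K, hK⟩ := hε
  obtain ⟨μ, hμ⟩ : ∃ μ, μ = Measure.infinitePi fun _ : ℕ => P.map (β 0) := ⟨_, rfl⟩
  have hT : ∀ i, Measurable (past β i) := measurable_past hβ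
  have hTμ : ∀ i, P.map (past β i) = μ := fun i => (map_past hβ hind hid i).trans hμ.symm
  have hrep' : ∀ i, 1 ≤ i → (fun ω => Y i ω - r (X i)) =ᵐ[P] fun ω => h (past β i ω) := hrep
  have hεi : Integrable (fun ω => Y 1 ω - r (X 1)) P := (hY 1 le_rfl).sub (integrable_const _)
  -- moments of `h` under the law `μ` of the past
  have hi : Integrable h μ := by
    rw [← hTμ (1 : ℕ)]
    exact (integrable_map_measure hh.aestronglyMeasurable (hT _).aemeasurable).2
      (hεi.congr (hrep' 1 le_rfl))
  have h0 : ∫ x, h x ∂μ = 0 := by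
    rw [← hTμ (1 : ℕ), integral_map (hT _).aemeasurable hh.aestronglyMeasurable,
      ← integral_congr_ae (hrep' 1 le_rfl), integral_sub (hY 1 le_rfl) (integrable_const _),
      hr 1 le_rfl]
    simp
  obtain ⟨D, hD, hψD⟩ : ∃ D : ℝ, 0 < D ∧
      ∫⁻ x, ENNReal.ofReal (psiExp p (‖h x‖ / D)) ∂μ ≤ 1 := by
    have hlt := hfin 1 le_rfl
    simp only [orliczNorm, iInf_lt_iff] at hlt
    obtain ⟨D, hD, hle, -⟩ := hlt
    refine ⟨D, hD, ?_⟩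
    have hm : Measurable fun x => ENNReal.ofReal (psiExp p (‖h x‖ / D)) :=
      ((continuous_psiExp_norm (by linarith) D).measurable.comp hh).ennreal_ofReal
    rw [← hTμ (1 : ℕ), lintegral_map hm (hT _)]
    refine (lintegral_congr_ae ?_).trans_le hle
    filter_upwards [hrep' 1 le_rfl] with ω hω
    rw [hω]
  -- the error of the `j`-dependent approximation
  have happrox : ∀ j, 1 ≤ j → ∀ C : ℝ, 0 < C → K * γ j < C →
      ∫⁻ x, ENNReal.ofReal (psiExp p (‖h x - headMean h μ j x‖ / C)) ∂μ ≤ 1 := by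
    intro j hj C hC hKC
    refine lintegral_psiExp_sub_headMean_le_one hβ hind hid hh hμ hi hp hC (hrep' j hj) ?_
    exact (((ENNReal.le_tsum 0).trans (hK j hj)).trans_lt
      ((ENNReal.ofReal_lt_ofReal_iff hC).2 hKC))
  obtain ⟨C₀, hsum, hC₀⟩ := (hsum.and (eventually_gt_atTop 0)).exists
  -- `K` may be negative, and a strict inequality is needed
  obtain ⟨L, hL, hKL⟩ : ∃ L : ℝ, 0 < L ∧ K < L := ⟨|K| + 1, by positivity, by
    linarith [le_abs_self K]⟩
  obtain ⟨c₁, hc₁, hvc⟩ := hvc.exists_pos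
  obtain ⟨c₂, hc₂, hvb⟩ := hvb.exists_pos
  have hvc := hvc.bound
  have hvb := hvb.bound
  -- at least `1 / n`, so that the argument of `ψ` below dominates that of the summability condition
  let s : ℕ → ℝ := fun n => √(∑ i, W n i ^ 2)
  have hsn : ∀ n : ℕ, 1 ≤ n → 1 / (n : ℝ) ≤ s n := fun n hn => one_div_le_sqrt_sum_sq hn (hW1 n hn)
  -- the events on which the two parts of the noise are large
  -- the factor `3` leaves `n ^ (-2)` after the union over at most `n` residue classes
  let G₁ : ℕ → Set Ω := fun n => {ω | m n * (D * s n * (3 * Real.log n))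
    ≤ ‖∑ i : Fin n, W n i • headMean h μ (m n) (past β ((i : ℕ) + 1 : ℕ) ω)‖}
  let G₂ : ℕ → Set Ω := fun n => {ω | L * C₀ * Real.log n ^ 2 * m n * s n
    ≤ ‖∑ i : Fin n, W n i • (h (past β ((i : ℕ) + 1 : ℕ) ω)
      - headMean h μ (m n) (past β ((i : ℕ) + 1 : ℕ) ω))‖}
  let f : ℕ → ℝ := fun n => 1 / psiExp p (C₀ * Real.log n ^ 2 * m n / (n * γ (m n)))
  have hf0 : ∀ n, 1 ≤ n → 0 ≤ f n := fun n hn => by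
    have := hγ (m n) (hm n hn).1
    exact one_div_nonneg.2 (psiExp_nonneg (by positivity))
  have hG₁ : ∀ n, 2 ≤ n → P (G₁ n) ≤ ENNReal.ofReal (2 * Real.exp 6 * (1 / (n : ℝ) ^ 2)) := by
    intro n hn
    have hn1 : 1 ≤ n := by omega
    have hn0 : (0 : ℝ) < n := by exact_mod_cast hn1
    have hs : 0 < s n := (by positivity : 0 < 1 / (n : ℝ)).trans_le (hsn n hn1)
    refine (measure_norm_sum_headMean_ge_le hβ hind hid hh hμ hi h0 hp hD hψD hs
      (mul_nonneg zero_le_three (Real.log_natCast_nonneg n)) (hm n hn1).1 (hW0 n)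
      (Real.sq_sqrt (Finset.sum_nonneg fun i _ => sq_nonneg _)).ge).trans ?_
    rw [← ENNReal.ofReal_natCast, ← ENNReal.ofReal_mul (Nat.cast_nonneg _)]
    refine ENNReal.ofReal_le_ofReal ?_
    have he : Real.exp (-(3 * Real.log n)) = 1 / (n : ℝ) ^ 3 := by
      rw [Real.exp_neg, mul_comm, Real.exp_mul, Real.exp_log hn0, one_div]
      norm_cast
    rw [he]
    have hmn : (m n : ℝ) ≤ n := by exact_mod_cast (hm n hn1).2
    calc (m n : ℝ) * (2 * Real.exp 6 * (1 / (n : ℝ) ^ 3))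
        ≤ n * (2 * Real.exp 6 * (1 / (n : ℝ) ^ 3)) := by gcongr
      _ = _ := by field_simp
  have hG₂ : ∀ n, 2 ≤ n → P (G₂ n) ≤ ENNReal.ofReal (f n + 1 / (n : ℝ) ^ 2) := by
    intro n hn
    have hn1 : 1 ≤ n := by omega
    have hn0 : (0 : ℝ) < n := by exact_mod_cast hn1
    have hn1' : (1 : ℝ) ≤ n := by exact_mod_cast hn1
    have hs : 0 < s n := (by positivity : 0 < 1 / (n : ℝ)).trans_le (hsn n hn1)
    have hlog : 0 < Real.log n := Real.log_pos (by exact_mod_cast hn)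
    have hm1 := (hm n hn1).1
    have hm0 : (0 : ℝ) < m n := by exact_mod_cast hm1
    have hgm : Measurable (headMean h μ (m n)) := by
      have : IsProbabilityMeasure (P.map (β 0)) :=
        Measure.isProbabilityMeasure_map (hβ 0).aemeasurable
      exact hμ ▸ measurable_headMean hh (P.map (β 0)) (m n)
    have ht : 0 < L * C₀ * Real.log n ^ 2 * m n * s n := by positivity
    have key : ∀ C, 0 < C → K * γ (m n) < C → P (G₂ n)
        ≤ ENNReal.ofReal (1 / psiExp p (L * C₀ * Real.log n ^ 2 * m n * s n / C)) := by
      intro C hC hKC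
      refine measure_norm_sum_ge_le_of_convex hp hC ht (hW0 n) (hW1 n hn1)
        (fun i => (hh.comp (hT _)).sub (hgm.comp (hT _))) fun i => ?_
      have hmeas : Measurable fun x =>
          ENNReal.ofReal (psiExp p (‖h x - headMean h μ (m n) x‖ / C)) :=
        ((continuous_psiExp_norm (by linarith) C).measurable.comp (hh.sub hgm)).ennreal_ofReal
      have := happrox (m n) hm1 C hC hKC
      rw [← hTμ (((i : ℕ) + 1 : ℕ) : ℤ), lintegral_map (hTμ _ ▸ hmeas) (hT _), hTμ] at this
      exact this
    rcases (hγ (m n) hm1).eq_or_lt with hγ0 | hγ0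
    · -- the approximation is exact, so that the scale `C` can be chosen arbitrarily small
      refine (key (L * C₀ * Real.log n ^ 2 * m n * s n / (n : ℝ) ^ 2) (by positivity)
        (by rw [← hγ0, mul_zero]; positivity)).trans (ENNReal.ofReal_le_ofReal ?_)
      rw [div_div_cancel₀ ht.ne']
      have h1 : (n : ℝ) ^ 2 ≤ psiExp p ((n : ℝ) ^ 2) := le_psiExp hp (one_le_pow₀ hn1')
      have := one_div_le_one_div_of_le (by positivity) h1
      linarith [hf0 n hn1]
    · refine (key (L * γ (m n)) (by positivity) (by gcongr)).trans (ENNReal.ofReal_le_ofReal ?_)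
      have harg : C₀ * Real.log n ^ 2 * m n / (n * γ (m n))
          ≤ L * C₀ * Real.log n ^ 2 * m n * s n / (L * γ (m n)) := by
        calc C₀ * Real.log n ^ 2 * m n / (n * γ (m n))
            = C₀ * Real.log n ^ 2 * m n * (1 / n) / γ (m n) := by field_simp
          _ ≤ C₀ * Real.log n ^ 2 * m n * s n / γ (m n) := by
              have := hsn n hn1
              gcongr
          _ = _ := by field_simp
      have hle := one_div_le_one_div_of_le (psiExp_pos (p := p) (by positivity))
        (psiExp_mono (p := p) (by linarith) (by positivity) harg)
      have : 0 ≤ 1 / (n : ℝ) ^ 2 := by positivity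
      linarith
  have hBC : ∀ᵐ ω ∂P, ∀ᶠ n in atTop, ω ∉ (if 2 ≤ n then G₁ n ∪ G₂ n else ∅) := by
    refine ae_eventually_notMem (ne_top_of_le_ne_top (Summable.tsum_ofReal_ne_top
      (f := fun n : ℕ => 2 * Real.exp 6 * (1 / (n : ℝ) ^ 2) + (f n + 1 / (n : ℝ) ^ 2)) ?_)
      (ENNReal.tsum_le_tsum fun n => ?_))
    · have h2 := Real.summable_one_div_nat_pow.2 one_lt_two
      exact (h2.mul_left _).add (hsum.add h2)
    · split_ifs with hn
      · have hfn := hf0 n (by omega)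
        rw [ENNReal.ofReal_add (by positivity) (by positivity)]
        exact (measure_union_le _ _).trans (add_le_add (hG₁ n hn) (hG₂ n hn))
      · simp
  have hall : ∀ᵐ ω ∂P, ∀ i, 1 ≤ i → Y i ω - r (X i) = h (past β i ω) :=
    ae_all_iff.2 fun i => eventually_imp_distrib_left.2 fun hi1 => hrep' i hi1
  filter_upwards [hBC, hall] with ω hω hYω
  refine IsBigO.of_bound (|A| + 2 * B * c₂ + (3 * D + L * C₀) * c₁) ?_
  have hB0 : 0 ≤ B := (norm_nonneg _).trans (hB x)
  filter_upwards [hω, hvb, hvc, hkn.eventually_lt_const zero_lt_one, eventually_ge_atTop 3]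
    with n hωn hvbn hvcn hknn hn3
  have hn1 : 1 ≤ n := by omega
  have hn0 : (0 : ℝ) < n := by exact_mod_cast hn1
  have hkn' : k n ≤ n := by
    have := (div_lt_one hn0).1 hknn
    exact_mod_cast this.le
  have hn3' : (3 : ℝ) ≤ n := by exact_mod_cast hn3
  have hlog1 : 1 ≤ Real.log n := by
    rw [Real.le_log_iff_exp_le hn0]
    linarith [Real.exp_one_lt_d9]
  rw [if_pos (by omega), Set.mem_union, not_or] at hωn
  have hN₁ : ‖∑ i : Fin n, W n i • headMean h μ (m n) (past β ((i : ℕ) + 1 : ℕ) ω)‖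
      ≤ m n * (D * s n * (3 * Real.log n)) :=
    (not_le.1 (show ¬ _ ≤ _ from hωn.1)).le
  have hN₂ : ‖∑ i : Fin n, W n i • (h (past β ((i : ℕ) + 1 : ℕ) ω)
      - headMean h μ (m n) (past β ((i : ℕ) + 1 : ℕ) ω))‖
      ≤ L * C₀ * Real.log n ^ 2 * m n * s n :=
    (not_le.1 (show ¬ _ ≤ _ from hωn.2)).le
  have hbias := norm_bias_le X x hα hB hA (hW0 n) (hW1 n hn1) hkn'
  have hdecomp : rHat W Y n ω - r x
      = ∑ i : Fin n, W n i • headMean h μ (m n) (past β ((i : ℕ) + 1 : ℕ) ω)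
        + ∑ i : Fin n, W n i • (h (past β ((i : ℕ) + 1 : ℕ) ω)
          - headMean h μ (m n) (past β ((i : ℕ) + 1 : ℕ) ω))
        + ∑ i : Fin n, W n i • (r (X (i + 1)) - r x) := by
    have hrx : r x = ∑ i : Fin n, W n i • r x := by rw [← Finset.sum_smul, hW1 n hn1, one_smul]
    rw [rHat, ← Finset.sum_add_distrib, ← Finset.sum_add_distrib]
    conv_lhs => rw [hrx, ← Finset.sum_sub_distrib]
    refine Finset.sum_congr rfl fun i _ => ?_
    rw [← hYω _ (Nat.le_add_left 1 i), ← smul_sub, ← smul_add, ← smul_add]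
    congr 1
    abel
  have hH : 0 ≤ knnDist X x n (k n) ^ α := Real.rpow_nonneg (knnDist_nonneg X x n _) _
  have hbn := hb0 n
  have hcn := hc0 n
  rw [Real.norm_of_nonneg (Real.sqrt_nonneg _), Real.norm_of_nonneg hcn] at hvcn
  have hsc : s n ≤ c₁ * c n := by
    refine le_trans (le_of_eq ?_) hvcn
    exact congrArg _ (Equiv.sum_comp (ranking X x n) fun i => W n i ^ 2).symm
  rw [Real.norm_of_nonneg hbn] at hvbn
  have htail := (Real.le_norm_self _).trans hvbn
  have hs0 : 0 ≤ s n := Real.sqrt_nonneg _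
  have hQ : 0 ≤ Real.log n ^ 2 * m n * c n := by positivity
  have hR : 0 ≤ √(γ 1 * firstWeight X x W n) := Real.sqrt_nonneg _
  have hnoise : m n * (D * s n * (3 * Real.log n)) + L * C₀ * Real.log n ^ 2 * m n * s n
      ≤ (3 * D + L * C₀) * c₁ * (Real.log n ^ 2 * m n * c n) := by
    have hl : Real.log n ≤ Real.log n ^ 2 := by nlinarith
    calc _ ≤ m n * (D * s n * (3 * Real.log n ^ 2)) + L * C₀ * Real.log n ^ 2 * m n * s n := by
          gcongr
      _ = (3 * D + L * C₀) * (Real.log n ^ 2 * m n * s n) := by ring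
      _ ≤ (3 * D + L * C₀) * (Real.log n ^ 2 * m n * (c₁ * c n)) := by gcongr
      _ = _ := by ring
  have htot : ‖rHat W Y n ω - r x‖ ≤ (3 * D + L * C₀) * c₁ * (Real.log n ^ 2 * m n * c n)
      + (|A| * knnDist X x n (k n) ^ α + 2 * B * (c₂ * b n)) := by
    rw [hdecomp]
    refine (norm_add₃_le).trans ?_
    have : 2 * B * _ ≤ 2 * B * (c₂ * b n) := mul_le_mul_of_nonneg_left htail (by positivity)
    linarith
  rw [norm_norm, Real.norm_of_nonneg (by positivity)]
  refine htot.trans ?_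
  have e1 : 0 ≤ (|A| + 2 * B * c₂) * (Real.log n ^ 2 * m n * c n) := by positivity
  have e2 : 0 ≤ (2 * B * c₂ + (3 * D + L * C₀) * c₁) * knnDist X x n (k n) ^ α := by positivity
  have e3 : 0 ≤ (|A| + (3 * D + L * C₀) * c₁) * b n := by positivity
  have e4 : 0 ≤ (|A| + 2 * B * c₂ + (3 * D + L * C₀) * c₁)
    * √(γ 1 * firstWeight X x W n) := by positivity
  linarith
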